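/- Let $A$ and $B$ be finite-dimensional quantum systems, let $\mathcal N,\mathcal M$ be quantum channels (completely positive trace-preserving maps) from $A$ to $B$, let $H$ be a grounded Hamiltonian on $A$ (Hermitian, with smallest eigenvalue $0$), and let $E>0$. For positive semidefinite $\rho,\sigma$, the Belavkin–Staszewski relative entropy is $\widehat D(\rho\|\sigma)=\operatorname{Tr}\big[\rho^{1/2}\ln(\rho^{1/2}\sigma^{-1}\rho^{1/2})\rho^{1/2}\big]$ if $\operatorname{supp}\rho\subseteq\operatorname{supp}\sigma$ (inverse and logarithm being taken on the supports), and $+\infty$ otherwise. Put $$\widehat D_{H,E}(\mathcal N\|\mathcal M)=\sup_{\psi_{RA}:\ \operatorname{Tr}[H\psi_A]\le E}\widehat D\big((\mathrm{id}_R\otimes\mathcal N)(\psi_{RA})\,\big\|\,(\mathrm{id}_R\otimes\mathcal M)(\psi_{RA})\big),$$ where the supremum is over all pure states $\psi_{RA}$ with a reference system $R$ of arbitrary finite dimension. For $n\ge1$, an $n$-round adaptive protocol consists of a memory $R$ of arbitrary finite dimension, an initial state $\tau^{(1)}$ of $RA$, channels $\mathcal A^{(1)},\dots,\mathcal A^{(n-1)}$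 from $RB$ to $RA$, and a measurement $(Q_0,Q_1)$ on $RB$ ($Q_0,Q_1\ge0$, $Q_0+Q_1=\mathbb 1$). When the unknown channel is $\mathcal E\in\{\mathcal N,\mathcal M\}$, set $\tau^{(1)}_{\mathcal E}=\tau^{(1)}$, $\tau^{(j+1)}_{\mathcal E}=\mathcal A^{(j)}\big((\mathrm{id}_R\otimes\mathcal E)(\tau^{(j)}_{\mathcal E})\big)$ and $\rho_{\mathcal E}=(\mathrm{id}_R\otimes\mathcal E)(\tau^{(n)}_{\mathcal E})$. The protocol obeys the average energy constraint if $\operatorname{Tr}\big[H\cdot\frac1n\sum_{j=1}^n\operatorname{Tr}_R\tau^{(j)}_{\mathcal E}\big]\le E$ for both $\mathcal E=\mathcal N$ and $\mathcal E=\mathcal M$. Let $\beta^\star_n(E,\varepsilon)$ be the infimum of the type-II error $\operatorname{Tr}[Q_0\rho_{\mathcal M}]$ over all $n$-round adaptive protocols that obey the average energy constraint and have type-I error $\operatorname{Tr}[Q_1\rho_{\mathcal N}]\le\varepsilon$. Then, with $h_2(\varepsilon)=-\varepsilon\ln\varepsilon-(1-\varepsilon)\ln(1-\varepsilon)$, for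 all $n\ge1$ and $\varepsilon\in[0,1)$, $$\frac{-\ln\beta^\star_n(E,\varepsilon)}{n}\le\frac1{1-\varepsilon}\Big(\widehat D_{H,E}(\mathcal N\|\mathcal M)+\frac{h_2(\varepsilon)}n\Big)$$ (in $[-\infty,+\infty]$, with $-\ln0=+\infty$). Moreover the limit $\lim_{\varepsilon\to0^+}\limsup_{n\to\infty}\frac{-\ln\beta^\star_n(E,\varepsilon)}n$ exists in $[-\infty,+\infty]$ and $$\lim_{\varepsilon\to0^+}\limsup_{n\to\infty}\frac{-\ln\beta^\star_n(E,\varepsilon)}n\le\widehat D_{H,E}(\mathcal N\|\mathcal M).$$ -/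

import Mathlib

open Matrix Filter Topology
open scoped ComplexOrder ENNReal

noncomputable section

namespace ChannelDiscrimination

/-- A quantum state (density matrix) of the finite-dimensional system with orthonormal basis `S`. -/
structure IsState {S : Type*} [Fintype S] (ρ : Matrix S S ℂ) : Prop where
  posSemidef : ρ.PosSemidef
  trace_eq_one : ρ.trace = 1

/-- The map `id_R ⊗ Φ` acting on operators of the composite system `R ⊗ A`. -/
def idTensor {A B : Type*} (R : Type*) (Φ : Matrix A A ℂ →ₗ[ℂ] Matrix B B ℂ)
    (X : Matrix (R × A) (R × A) ℂ) : Matrix (R × B) (R × B) ℂ :=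
  Matrix.of fun p q => Φ (Matrix.of fun a a' => X (p.1, a) (q.1, a')) p.2 q.2

/-- A quantum channel: a completely positive and trace-preserving linear map. -/
structure IsChannel {A B : Type*} [Fintype A] [Fintype B]
    (Φ : Matrix A A ℂ →ₗ[ℂ] Matrix B B ℂ) : Prop where
  completelyPositive : ∀ (k : ℕ) (X : Matrix (Fin k × A) (Fin k × A) ℂ),
    X.PosSemidef → (idTensor (Fin k) Φ X).PosSemidef
  tracePreserving : ∀ X : Matrix A A ℂ, (Φ X).trace = X.trace

/-- The reduced operator on `A` of an operator on `R ⊗ A`, that is, the partial trace over `R`. -/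
def reduced {R A : Type*} [Fintype R] (X : Matrix (R × A) (R × A) ℂ) : Matrix A A ℂ :=
  Matrix.of fun a a' => ∑ r, X (r, a) (r, a')

/-- A grounded Hamiltonian: Hermitian with smallest eigenvalue equal to zero. -/
def IsGrounded {A : Type*} [Fintype A] (H : Matrix A A ℂ) : Prop :=
  H.PosSemidef ∧ ∃ v : A → ℂ, v ≠ 0 ∧ H *ᵥ v = 0

/-- The energy `Tr[H ρ]`. -/
def energy {A : Type*} [Fintype A] (H ρ : Matrix A A ℂ) : ℝ := (H * ρ).trace.re

/-- The operator relative entropy `ρ^{1/2} ln (ρ^{1/2} σ⁻¹ ρ^{1/2}) ρ^{1/2}`. The inverse is taken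
on the support of `σ` (as `0⁻¹ = 0`). When the support of `ρ` is contained in that of `σ`, the
argument of the logarithm has the same support as `ρ`, and the value `Real.log 0 = 0` on the
complement is irrelevant. -/
def opRelEntropy {S : Type*} [Fintype S] [DecidableEq S] (ρ σ : Matrix S S ℂ) : Matrix S S ℂ :=
  cfc Real.sqrt ρ *
    cfc Real.log (cfc Real.sqrt ρ * cfc (fun x : ℝ => x⁻¹) σ * cfc Real.sqrt ρ) *
    cfc Real.sqrt ρ

open Classical in
/-- The Belavkin–Staszewski relative entropy of positive semidefinite matrices: the trace of the
operator relative entropy if `supp ρ ⊆ supp σ` (equivalently `ker σ ⊆ ker ρ`), and `+∞` if not. -/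
def bsRelEntropy {S : Type*} [Fintype S] [DecidableEq S] (ρ σ : Matrix S S ℂ) : EReal :=
  if ∀ v : S → ℂ, σ *ᵥ v = 0 → ρ *ᵥ v = 0 then
    (((opRelEntropy ρ σ).trace.re : ℝ) : EReal)
  else ⊤

/-- The rank-one operator `|ψ⟩⟨ψ|`. -/
def ketBra {S : Type*} (ψ : S → ℂ) : Matrix S S ℂ := Matrix.vecMulVec ψ (star ψ)

/-- The energy-constrained Belavkin–Staszewski channel divergence: the supremum over pure states
`ψ` of `R ⊗ A`, with a reference system `R` of any finite dimension `d`, that satisfy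
`Tr[H ψ_A] ≤ E`. -/
def ecbsDivergence {A B : Type*} [Fintype A] [Fintype B] [DecidableEq B]
    (H : Matrix A A ℂ) (E : ℝ) (N M : Matrix A A ℂ →ₗ[ℂ] Matrix B B ℂ) : EReal :=
  ⨆ (d : ℕ) (ψ : Fin d × A → ℂ) (_ : IsState (ketBra ψ))
    (_ : energy H (reduced (ketBra ψ)) ≤ E),
    bsRelEntropy (idTensor (Fin d) N (ketBra ψ)) (idTensor (Fin d) M (ketBra ψ))

/-- An adaptive strategy that queries a channel from `A` to `B` in `n` rounds, with a memory `R` of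
any finite dimension: an initial state of `R ⊗ A`, channels from `R ⊗ B` to `R ⊗ A` applied between
consecutive queries (`adapt j` comes after query `j`, where queries are counted from `0`; only
`adapt 0, …, adapt (n - 2)` are used), and a final two-outcome measurement `(Q₀, Q₁)` on
`R ⊗ B`. -/
structure Protocol (A B : Type*) [Fintype A] [Fintype B] [DecidableEq B] (n : ℕ) where
  dimR : ℕ
  init : Matrix (Fin dimR × A) (Fin dimR × A) ℂ
  init_isState : IsState init
  adapt : ℕ → Matrix (Fin dimR × B) (Fin dimR × B) ℂ →ₗ[ℂ] Matrix (Fin dimR × A) (Fin dimR × A) ℂ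
  adapt_isChannel : ∀ j, j + 1 < n → IsChannel (adapt j)
  Q₀ : Matrix (Fin dimR × B) (Fin dimR × B) ℂ
  Q₁ : Matrix (Fin dimR × B) (Fin dimR × B) ℂ
  Q₀_posSemidef : Q₀.PosSemidef
  Q₁_posSemidef : Q₁.PosSemidef
  Q_sum : Q₀ + Q₁ = 1

namespace Protocol

variable {A B : Type*} [Fintype A] [Fintype B] [DecidableEq B] {n : ℕ}

/-- The state of `R ⊗ A` just before query `j` (counted from `0`) when the channel is `Φ`. -/
def probe (P : Protocol A B n) (Φ : Matrix A A ℂ →ₗ[ℂ] Matrix B B ℂ) :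
    ℕ → Matrix (Fin P.dimR × A) (Fin P.dimR × A) ℂ
  | 0 => P.init
  | j + 1 => P.adapt j (idTensor (Fin P.dimR) Φ (probe P Φ j))

/-- The state of `R ⊗ B` after the last of the `n ≥ 1` queries when the channel is `Φ`. -/
def output (P : Protocol A B n) (Φ : Matrix A A ℂ →ₗ[ℂ] Matrix B B ℂ) :
    Matrix (Fin P.dimR × B) (Fin P.dimR × B) ℂ :=
  idTensor (Fin P.dimR) Φ (P.probe Φ (n - 1))

/-- The average `(1/n) ∑_j τ^{(j)}` of the reduced states at the inputs of the `n` queries. -/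
def averageInput (P : Protocol A B n) (Φ : Matrix A A ℂ →ₗ[ℂ] Matrix B B ℂ) : Matrix A A ℂ :=
  (1 / (n : ℂ)) • ∑ j ∈ Finset.range n, reduced (P.probe Φ j)

/-- The average energy constraint, imposed under both hypotheses. -/
def ObeysEnergyConstraint (P : Protocol A B n) (H : Matrix A A ℂ) (E : ℝ)
    (N M : Matrix A A ℂ →ₗ[ℂ] Matrix B B ℂ) : Prop :=
  energy H (P.averageInput N) ≤ E ∧ energy H (P.averageInput M) ≤ E

/-- Probability of deciding `M` (outcome `1`) when the channel is `N`. -/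
def typeIError (P : Protocol A B n) (N : Matrix A A ℂ →ₗ[ℂ] Matrix B B ℂ) : ℝ :=
  (P.Q₁ * P.output N).trace.re

/-- Probability of deciding `N` (outcome `0`) when the channel is `M`. -/
def typeIIError (P : Protocol A B n) (M : Matrix A A ℂ →ₗ[ℂ] Matrix B B ℂ) : ℝ :=
  (P.Q₀ * P.output M).trace.re

end Protocol

/-- The optimal type-II error probability `β*_n(E, ε)`: the infimum of the type-II error over the
`n`-round protocols that obey the energy constraint and have type-I error at most `ε`. -/
def optimalTypeIIError {A B : Type*} [Fintype A] [Fintype B] [DecidableEq B]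
    (H : Matrix A A ℂ) (E : ℝ) (N M : Matrix A A ℂ →ₗ[ℂ] Matrix B B ℂ) (n : ℕ) (ε : ℝ) : ℝ≥0∞ :=
  ⨅ (P : Protocol A B n) (_ : P.ObeysEnergyConstraint H E N M) (_ : P.typeIError N ≤ ε),
    ENNReal.ofReal (P.typeIIError M)

/-- The rate `-ln β*_n(E, ε) / n`, equal to `+∞` if `β*_n(E, ε) = 0` (and `n ≥ 1`). -/
def typeIIRate {A B : Type*} [Fintype A] [Fintype B] [DecidableEq B]
    (H : Matrix A A ℂ) (E : ℝ) (N M : Matrix A A ℂ →ₗ[ℂ] Matrix B B ℂ) (n : ℕ) (ε : ℝ) : EReal :=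
  (-ENNReal.log (optimalTypeIIError H E N M n ε)) / (n : EReal)

end ChannelDiscrimination

end

/-! If the divergence is infinite, the rate bound is trivial. If it is finite, evaluate it at a
purification of one invertible state of energy at most $E$, which exists because $H$ is grounded and
$E>0$. There the support condition gives a common factorization $VDV^\dagger$, $VV^\dagger$ of the
two outputs (`exists_factorization`). Undoing the purification turns this into $\mathcal M=\sum_k
K_k\cdot K_k^\dagger$ and $\mathcal N=\sum_k\mu_k K_k\cdot K_k^\dagger$ with $\mu_k\ge0$
(`exists_common_kraus`).

For such a pair, the Belavkin–Staszewski entropy of the outputs at a pure state of full Schmidt rank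
depends only on the reduced input $\rho$ and is linear in it: it is
$F(\rho)=\sum_k\mu_k\ln\mu_k\operatorname{Tr}[K_k\rho K_k^\dagger]$. Mixing with an invertible state
and passing to the limit bounds $F$ by the divergence on all admissible inputs
(`divergenceFunctional_le`).

The same Kraus operators simulate the protocol classically: the states under $\mathcal N$ and
$\mathcal M$ stay of the form $\sum_i w_iZ_i$ and $\sum_iZ_i$. A query costs exactly $F$ of its
input under $\mathcal N$ (`HasReverseTest.query`), and channels in between cost nothing. By
linearity the total is $n$ times $F$ of the average input, which is why an average energy constraint
suffices. The final test obeys a classical log-sum converse (`HasReverseTest.converse`). -/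

noncomputable section

namespace ChannelDiscrimination

/-! ### Common factorizations and the operator relative entropy -/

section MatrixLemmas

variable {S κ : Type*} [Fintype S] [DecidableEq S] [Fintype κ] [DecidableEq κ]

theorem cfc_mul_cfc (f g : ℝ → ℝ) (a : Matrix S S ℂ) :
    cfc f a * cfc g a = cfc (fun x => f x * g x) a :=
  (cfc_mul f g a (Matrix.finite_real_spectrum.continuousOn f)
    (Matrix.finite_real_spectrum.continuousOn g)).symm

theorem conjTranspose_cfc (f : ℝ → ℝ) (a : Matrix S S ℂ) : (cfc f a)ᴴ = cfc f a :=
  (cfc_predicate f a : IsSelfAdjoint (cfc f a)).star_eq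

theorem spectrum_nonneg {a : Matrix S S ℂ} (ha : a.PosSemidef) {x : ℝ}
    (hx : x ∈ spectrum ℝ a) : 0 ≤ x := by
  rw [ha.1.spectrum_real_eq_range_eigenvalues] at hx
  obtain ⟨i, rfl⟩ := hx
  exact ha.eigenvalues_nonneg i

theorem cfc_sqrt_mul_self {a : Matrix S S ℂ} (ha : a.PosSemidef) :
    cfc Real.sqrt a * cfc Real.sqrt a = a := by
  rw [cfc_mul_cfc]
  conv_rhs => rw [← cfc_id ℝ a ha.1]
  exact cfc_congr fun x hx => Real.mul_self_sqrt (spectrum_nonneg ha hx)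

theorem mul_cfc_inv_mul_self {a : Matrix S S ℂ} (ha : a.PosSemidef) :
    a * cfc (fun x : ℝ => x⁻¹) a * a = a := by
  have h : cfc (id : ℝ → ℝ) a = a := cfc_id ℝ a ha.1
  have h2 : cfc (id : ℝ → ℝ) a * cfc (fun x : ℝ => x⁻¹) a * cfc (id : ℝ → ℝ) a =
      cfc (id : ℝ → ℝ) a := by
    rw [cfc_mul_cfc, cfc_mul_cfc]
    refine cfc_congr fun x _ => ?_
    exact mul_inv_mul_cancel x
  rwa [h] at h2

theorem mul_eq_zero_of_ker {l m n p : Type*} [Fintype m] [Fintype n] {V : Matrix l m ℂ}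
    {D : Matrix n m ℂ} (h : ∀ x : m → ℂ, V *ᵥ x = 0 → D *ᵥ x = 0) {X : Matrix m p ℂ}
    (hX : V * X = 0) : D * X = 0 := by
  ext i j
  have h1 : V *ᵥ (fun k => X k j) = 0 := by
    ext i'
    exact congrFun (congrFun hX i') j
  exact congrFun (h _ h1) i

/-- The operator relative entropy of two matrices with a common factorization. -/
theorem opRelEntropy_of_factorization (V : Matrix S κ ℂ) (μ : κ → ℝ) (hμ : ∀ k, 0 ≤ μ k)
    (hker : ∀ x : κ → ℂ, V *ᵥ x = 0 → diagonal (fun k => (μ k : ℂ)) *ᵥ x = 0) :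
    opRelEntropy (V * diagonal (fun k => (μ k : ℂ)) * Vᴴ) (V * Vᴴ) =
      V * diagonal (fun k => ((μ k * Real.log (μ k) : ℝ) : ℂ)) * Vᴴ := by
  set D : Matrix κ κ ℂ := diagonal (fun k => (μ k : ℂ)) with hD
  set ρ := V * D * Vᴴ with hρd
  set σ := V * Vᴴ with hσd
  have hDp : D.PosSemidef := posSemidef_diagonal_iff.2 fun k => by exact_mod_cast hμ k
  have hρ : ρ.PosSemidef := hDp.mul_mul_conjTranspose_same V
  have hσ : σ.PosSemidef := posSemidef_self_mul_conjTranspose V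
  set r := cfc Real.sqrt ρ with hr
  set s := cfc (fun x : ℝ => x⁻¹) σ with hs
  have hrr : r * r = ρ := cfc_sqrt_mul_self hρ
  have hV : σ * s * V = V := by
    -- `σ * s` fixes `σ = V * Vᴴ`, hence fixes `V`, because `X * Xᴴ = 0` forces `X = 0`.
    have h0 : (1 - σ * s) * V * ((1 - σ * s) * V)ᴴ = 0 := by
      have h1 : (1 - σ * s) * σ = 0 := by
        rw [sub_mul, one_mul, mul_cfc_inv_mul_self hσ, sub_self]
      rw [conjTranspose_mul, ← Matrix.mul_assoc, Matrix.mul_assoc _ V, ← hσd, h1,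
        Matrix.zero_mul]
    have h2 := self_mul_conjTranspose_eq_zero.1 h0
    rw [Matrix.sub_mul, Matrix.one_mul, sub_eq_zero] at h2
    exact h2.symm
  -- The columns of `Vᴴ * s * V * D - D` lie in the kernel of `V`, hence in that of `D`. So `Vᴴ * s
  -- * V` acts as the identity between two factors `D`.
  have hDD : D * (Vᴴ * s * V) * D = D * D := by
    have h1 : V * (Vᴴ * s * V * D - D) = 0 := by
      rw [Matrix.mul_sub, sub_eq_zero]
      simp only [← Matrix.mul_assoc]
      rw [← hσd, hV]
    have h2 := mul_eq_zero_of_ker hker h1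
    rw [Matrix.mul_sub, sub_eq_zero] at h2
    rw [← h2]
    simp only [Matrix.mul_assoc]
  have hpow : ∀ k : ℕ, r * (r * s * r) ^ k * r = V * D ^ (k + 1) * Vᴴ := by
    intro k
    induction k with
    | zero => simp [hrr, hρd]
    | succ k ih =>
      have : r * (r * s * r) ^ (k + 1) * r = (r * (r * s * r) ^ k * r) * s * (r * r) := by
        rw [pow_succ]; simp only [Matrix.mul_assoc]
      rw [this, ih, hrr, hρd]
      calc V * D ^ (k + 1) * Vᴴ * s * (V * D * Vᴴ)
          = V * D ^ k * (D * (Vᴴ * s * V) * D) * Vᴴ := by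
            rw [pow_succ]; simp only [Matrix.mul_assoc]
        _ = V * D ^ (k + 1 + 1) * Vᴴ := by
            rw [hDD, pow_succ, pow_succ]; simp only [Matrix.mul_assoc]
  have hpoly : ∀ p : Polynomial ℝ,
      r * Polynomial.aeval (r * s * r) p * r = V * (D * Polynomial.aeval D p) * Vᴴ := by
    intro p
    induction p using Polynomial.induction_on' with
    | add p q hp hq => simp only [map_add, mul_add, add_mul, Matrix.mul_add, Matrix.add_mul, hp, hq]
    | monomial k c =>
      rw [Polynomial.aeval_monomial, Polynomial.aeval_monomial, ← Algebra.smul_def,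
        ← Algebra.smul_def]
      simp only [Matrix.mul_smul, Matrix.smul_mul]
      rw [hpow, pow_succ']
  have hT : (r * s * r).IsHermitian := by
    rw [IsHermitian, conjTranspose_mul, conjTranspose_mul, hr, hs, conjTranspose_cfc,
      conjTranspose_cfc, Matrix.mul_assoc]
  classical
  -- One polynomial agrees with `Real.log` both on the spectrum of `r * s * r` and at all `μ k`, so
  -- the identity for polynomials applies to the logarithm.
  let F : Finset ℝ :=
    (Matrix.finite_real_spectrum (A := r * s * r)).toFinset ∪ Finset.univ.image μ
  let p := Lagrange.interpolate F id Real.log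
  have hp : ∀ x ∈ F, p.eval x = Real.log x := fun x hx =>
    Lagrange.eval_interpolate_at_node (v := id) Real.log (Set.injOn_id _) hx
  have hlog : cfc Real.log (r * s * r) = Polynomial.aeval (r * s * r) p := by
    rw [← cfc_polynomial p (r * s * r) hT]
    refine cfc_congr fun x hx => (hp x ?_).symm
    exact Finset.mem_union_left _ ((Set.Finite.mem_toFinset _).2 hx)
  have hdiag : ∀ q : Polynomial ℝ,
      Polynomial.aeval D q = diagonal (fun k => ((q.eval (μ k) : ℝ) : ℂ)) := by
    intro q
    induction q using Polynomial.induction_on' with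
    | add p q hp hq => rw [map_add, hp, hq, diagonal_add]; simp
    | monomial k c =>
      rw [Polynomial.aeval_monomial, ← Algebra.smul_def, hD, diagonal_pow, ← diagonal_smul]
      congr 1
      ext i
      simp
  rw [opRelEntropy, hlog, hpoly, hdiag, hD, diagonal_mul_diagonal]
  congr 3
  ext k
  rw [hp (μ k) (Finset.mem_union_right _ (Finset.mem_image_of_mem _ (Finset.mem_univ k)))]
  push_cast; rfl

/-- Two positive semidefinite matrices with `ker σ ⊆ ker ρ` have a common factorization. -/
theorem exists_factorization {ρ σ : Matrix S S ℂ} (hρ : ρ.PosSemidef) (hσ : σ.PosSemidef)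
    (h : ∀ v : S → ℂ, σ *ᵥ v = 0 → ρ *ᵥ v = 0) :
    ∃ (V : Matrix S S ℂ) (μ : S → ℝ), (∀ k, 0 ≤ μ k) ∧ V * Vᴴ = σ ∧
      V * diagonal (fun k => (μ k : ℂ)) * Vᴴ = ρ ∧
      ∀ x : S → ℂ, V *ᵥ x = 0 → diagonal (fun k => (μ k : ℂ)) *ᵥ x = 0 := by
  set R := cfc Real.sqrt σ with hR
  set I := cfc (fun x : ℝ => (Real.sqrt x)⁻¹) σ with hI
  -- The projection onto the support of `σ`; `R` and `I` are the square root of `σ` and its inverse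
  -- on the support.
  set T := cfc (fun x : ℝ => Real.sqrt x * (Real.sqrt x)⁻¹) σ with hTd
  have hRR : R * R = σ := cfc_sqrt_mul_self hσ
  have hRI : R * I = T := cfc_mul_cfc _ _ _
  have hIR : I * R = T := by
    rw [hI, hR, cfc_mul_cfc, hTd]; congr 1; ext x; exact mul_comm _ _
  have hIT : I * T = I := by
    rw [hI, hTd, cfc_mul_cfc]; congr 1; ext x
    by_cases hx : Real.sqrt x = 0 <;> simp [hx]
  have hRT : R * T = R := by
    rw [hR, hTd, cfc_mul_cfc]; congr 1; ext x
    by_cases hx : Real.sqrt x = 0 <;> simp [hx]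
  have hσT : σ * (1 - T) = 0 := by
    rw [Matrix.mul_sub, Matrix.mul_one, ← hRR, Matrix.mul_assoc, hRT, sub_self]
  have hρT : ρ * T = ρ := by
    have := mul_eq_zero_of_ker h hσT
    rw [Matrix.mul_sub, Matrix.mul_one, sub_eq_zero] at this
    exact this.symm
  have hTρ : T * ρ = ρ := by
    have := congrArg conjTranspose hρT
    rwa [conjTranspose_mul, hTd, conjTranspose_cfc, hρ.1.eq] at this
  have hIh : Iᴴ = I := conjTranspose_cfc _ _
  have hRh : Rᴴ = R := conjTranspose_cfc _ _
  have hDp : (I * ρ * I).PosSemidef := by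
    have := hρ.mul_mul_conjTranspose_same I
    rwa [hIh] at this
  set D := I * ρ * I with hDd
  set U : Matrix S S ℂ := (hDp.1.eigenvectorUnitary : Matrix S S ℂ) with hU
  set Λ : Matrix S S ℂ := diagonal (fun k => (hDp.1.eigenvalues k : ℂ)) with hΛ
  have hUU : U * Uᴴ = 1 := Unitary.mul_star_self_of_mem hDp.1.eigenvectorUnitary.2
  have hUU' : Uᴴ * U = 1 := Unitary.star_mul_self_of_mem hDp.1.eigenvectorUnitary.2
  have hspec : D = U * Λ * Uᴴ := by
    have := hDp.1.spectral_theorem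
    rw [Unitary.conjStarAlgAut_apply] at this
    exact this
  -- Here `U` diagonalizes $\sigma^{-1/2}\rho\sigma^{-1/2}$, and the weights are its eigenvalues.
  refine ⟨R * U, hDp.1.eigenvalues, hDp.eigenvalues_nonneg, ?_, ?_, ?_⟩
  · rw [conjTranspose_mul, hRh, Matrix.mul_assoc, ← Matrix.mul_assoc U, hUU, Matrix.one_mul, hRR]
  · calc R * U * Λ * (R * U)ᴴ = R * (U * Λ * Uᴴ) * R := by
          rw [conjTranspose_mul, hRh]; simp only [Matrix.mul_assoc]
      _ = (R * I) * ρ * (I * R) := by rw [← hspec, hDd]; simp only [Matrix.mul_assoc]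
      _ = ρ := by rw [hRI, hIR, hTρ, hρT]
  · intro x hx
    -- `Λ` factors on the right through `R * U`, so it vanishes on the kernel of `R * U`.
    have h1 : Λ * Uᴴ * U = Uᴴ * (I * ρ * I * (I * R)) * U := by
      rw [hIR, Matrix.mul_assoc _ I T, hIT, ← hDd, hspec]
      simp only [← Matrix.mul_assoc]
      rw [hUU', Matrix.one_mul]
    have h2 : Λ = Uᴴ * (I * ρ * I * I) * (R * U) := by
      rw [Matrix.mul_assoc, hUU', Matrix.mul_one] at h1
      rw [h1]; simp only [Matrix.mul_assoc]
    change Λ *ᵥ x = 0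
    rw [h2, ← Matrix.mulVec_mulVec, hx, Matrix.mulVec_zero]

end MatrixLemmas

/-! ### Ampliated maps and common Kraus operators -/

section Ampliation

variable {R A B κ : Type*}

theorem idTensor_apply (Φ : Matrix A A ℂ →ₗ[ℂ] Matrix B B ℂ) (X : Matrix (R × A) (R × A) ℂ)
    (p q : R × B) :
    idTensor R Φ X p q = Φ (Matrix.of fun a a' => X (p.1, a) (q.1, a')) p.2 q.2 := rfl

/-- `idTensor R Φ` as a linear map. -/
def idTensorLin (R : Type*) (Φ : Matrix A A ℂ →ₗ[ℂ] Matrix B B ℂ) :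
    Matrix (R × A) (R × A) ℂ →ₗ[ℂ] Matrix (R × B) (R × B) ℂ where
  toFun := idTensor R Φ
  map_add' X Y := by
    ext p q
    simp only [idTensor_apply, Matrix.add_apply]
    rw [← Matrix.add_apply, ← map_add]; rfl
  map_smul' c X := by
    ext p q
    simp only [idTensor_apply, Matrix.smul_apply, RingHom.id_apply]
    rw [← Matrix.smul_apply, ← map_smul]; rfl

theorem idTensor_sum {ι : Type*} [Fintype ι] (Φ : Matrix A A ℂ →ₗ[ℂ] Matrix B B ℂ) (c : ι → ℂ)
    (X : ι → Matrix (R × A) (R × A) ℂ) :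
    idTensor R Φ (∑ i, c i • X i) = ∑ i, c i • idTensor R Φ (X i) := by
  have := map_sum (idTensorLin R Φ) (fun i => c i • X i) Finset.univ
  simp only [map_smul] at this
  exact this

theorem trace_idTensor [Fintype R] [Fintype A] [Fintype B]
    (Φ : Matrix A A ℂ →ₗ[ℂ] Matrix B B ℂ) (X : Matrix (R × A) (R × A) ℂ) :
    (idTensor R Φ X).trace = (Φ (reduced X)).trace := by
  have : reduced X = ∑ r, Matrix.of fun a a' => X (r, a) (r, a') := by
    ext a a'; simp [reduced, Matrix.sum_apply]
  rw [this, map_sum, trace_sum, Matrix.trace, Fintype.sum_prod_type]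
  rfl

theorem trace_reduced [Fintype R] [Fintype A] (X : Matrix (R × A) (R × A) ℂ) :
    (reduced X).trace = X.trace := by
  rw [Matrix.trace, Matrix.trace, Fintype.sum_prod_type, Finset.sum_comm]
  rfl

theorem posSemidef_reduced [Fintype R] [Fintype A] {X : Matrix (R × A) (R × A) ℂ}
    (hX : X.PosSemidef) : (reduced X).PosSemidef := by
  have : reduced X = ∑ r, X.submatrix (fun a => (r, a)) (fun a => (r, a)) := by
    ext a a'; simp [reduced, Matrix.sum_apply]
  rw [this]
  exact posSemidef_sum _ fun r _ => hX.submatrix _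

theorem IsState.reduced [Fintype R] [Fintype A] {X : Matrix (R × A) (R × A) ℂ}
    (hX : IsState X) : IsState (reduced X) :=
  ⟨posSemidef_reduced hX.1, by rw [trace_reduced, hX.2]⟩

theorem IsChannel.trace_idTensor [Fintype R] [Fintype A] [Fintype B]
    {Φ : Matrix A A ℂ →ₗ[ℂ] Matrix B B ℂ} (hΦ : IsChannel Φ) (X : Matrix (R × A) (R × A) ℂ) :
    (idTensor R Φ X).trace = X.trace := by
  rw [ChannelDiscrimination.trace_idTensor, hΦ.2, trace_reduced]

theorem IsChannel.posSemidef_map [Fintype A] [Fintype B]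
    {Φ : Matrix A A ℂ →ₗ[ℂ] Matrix B B ℂ} (hΦ : IsChannel Φ) {X : Matrix A A ℂ}
    (hX : X.PosSemidef) : (Φ X).PosSemidef :=
  (hΦ.1 1 _ (hX.submatrix Prod.snd)).submatrix (fun b => ((0 : Fin 1), b))

theorem IsChannel.isState_map [Fintype A] [Fintype B]
    {Φ : Matrix A A ℂ →ₗ[ℂ] Matrix B B ℂ} (hΦ : IsChannel Φ) {X : Matrix A A ℂ}
    (hX : IsState X) : IsState (Φ X) :=
  ⟨hΦ.posSemidef_map hX.1, by rw [hΦ.2, hX.2]⟩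

theorem IsChannel.isState_idTensor {d : ℕ} [Fintype A] [Fintype B]
    {Φ : Matrix A A ℂ →ₗ[ℂ] Matrix B B ℂ} (hΦ : IsChannel Φ)
    {X : Matrix (Fin d × A) (Fin d × A) ℂ} (hX : IsState X) : IsState (idTensor (Fin d) Φ X) :=
  ⟨hΦ.1 d X hX.1, by rw [hΦ.trace_idTensor, hX.2]⟩

/-- The map `X ↦ E X E†`. -/
def conjMap [Fintype A] (E : Matrix B A ℂ) : Matrix A A ℂ →ₗ[ℂ] Matrix B B ℂ where
  toFun X := E * X * Eᴴ
  map_add' X Y := by rw [Matrix.mul_add, Matrix.add_mul]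
  map_smul' c X := by simp

theorem conjMap_apply [Fintype A] (E : Matrix B A ℂ) (X : Matrix A A ℂ) :
    conjMap E X = E * X * Eᴴ := rfl

/-- The map `X ↦ ∑ k, w k • E k X (E k)†`. -/
def krausMap [Fintype A] [Fintype κ] (w : κ → ℝ) (E : κ → Matrix B A ℂ) :
    Matrix A A ℂ →ₗ[ℂ] Matrix B B ℂ :=
  ∑ k, (w k : ℂ) • conjMap (E k)

theorem idTensor_krausMap [Fintype A] [Fintype κ] (w : κ → ℝ) (E : κ → Matrix B A ℂ)
    (X : Matrix (R × A) (R × A) ℂ) :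
    idTensor R (krausMap w E) X = ∑ k, (w k : ℂ) • idTensor R (conjMap (E k)) X := by
  ext p q
  simp [idTensor_apply, krausMap, Matrix.sum_apply]

theorem posSemidef_idTensor_conjMap [Fintype R] [Fintype A] [Fintype B] (E : Matrix B A ℂ)
    {X : Matrix (R × A) (R × A) ℂ} (hX : X.PosSemidef) :
    (idTensor R (conjMap E) X).PosSemidef := by
  classical
  let K : Matrix (R × B) (R × A) ℂ := Matrix.of fun p q => if p.1 = q.1 then E p.2 q.2 else 0
  have : idTensor R (conjMap E) X = K * X * Kᴴ := by
    ext p q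
    simp [idTensor_apply, conjMap, Matrix.mul_apply, K, Fintype.sum_prod_type,
      Finset.sum_ite_irrel, apply_ite, ite_mul]
  rw [this]
  exact hX.mul_mul_conjTranspose_same K

theorem mul_diagonal_mul_conjTranspose_apply {m n : Type*} [Fintype n] [DecidableEq n]
    (V : Matrix m n ℂ) (w : n → ℂ) (p q : m) :
    (V * diagonal w * Vᴴ) p q = ∑ k, V p k * w k * star (V q k) := by
  rw [Matrix.mul_apply]
  simp only [mul_diagonal, conjTranspose_apply]

theorem idTensor_krausMap_ketBra [Fintype R] [Fintype A] [Fintype κ] [DecidableEq κ] (w : κ → ℝ)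
    (E : κ → Matrix B A ℂ) (ψ : R × A → ℂ) (W : Matrix (R × B) κ ℂ)
    (hW : W = Matrix.of fun p k => ∑ a, E k p.2 a * ψ (p.1, a)) :
    idTensor R (krausMap w E) (ketBra ψ) = W * diagonal (fun k => (w k : ℂ)) * Wᴴ := by
  ext p q
  rw [idTensor_krausMap, mul_diagonal_mul_conjTranspose_apply]
  simp only [Matrix.sum_apply, Matrix.smul_apply, smul_eq_mul, idTensor_apply]
  refine Finset.sum_congr rfl fun k _ => ?_
  have : (conjMap (E k)) (Matrix.of fun a a' => ketBra ψ (p.1, a) (q.1, a')) p.2 q.2 =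
      W p k * star (W q k) := by
    simp only [conjMap, LinearMap.coe_mk, AddHom.coe_mk, Matrix.mul_apply, Matrix.of_apply, hW,
      ketBra, vecMulVec_apply, conjTranspose_apply, star_sum, star_mul', Finset.sum_mul,
      Finset.mul_sum, Pi.star_apply]
    exact Finset.sum_congr rfl fun _ _ => Finset.sum_congr rfl fun _ _ => by ring
  rw [this]; ring

theorem reduced_ketBra [Fintype R] [Fintype A] (G : Matrix R A ℂ) :
    reduced (ketBra fun p : R × A => G p.1 p.2) = Gᵀ * Gᵀᴴ := by
  ext a a'
  simp [reduced, ketBra, vecMulVec_apply, Matrix.mul_apply]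

/-- A linear map is determined by its value on a pure state of full Schmidt rank. -/
theorem eq_krausMap_of_idTensor_ketBra [Fintype R] [Fintype A] [DecidableEq A] [Fintype κ]
    [DecidableEq κ] {Φ : Matrix A A ℂ →ₗ[ℂ] Matrix B B ℂ} {G : Matrix R A ℂ} {L : Matrix A R ℂ}
    (hLG : L * G = 1) {V : Matrix (R × B) κ ℂ} {w : κ → ℝ}
    (h : idTensor R Φ (ketBra fun p : R × A => G p.1 p.2) =
      V * diagonal (fun k => (w k : ℂ)) * Vᴴ) :
    Φ = krausMap w fun k => Matrix.of fun b a => ∑ i, L a i * V (i, b) k := by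
  refine LinearMap.ext fun X => ?_
  -- The rows of `G` span, so `X` is a combination of the blocks of the pure state; `c` holds the
  -- coefficients given by the left inverse `L`.
  set c : Matrix R R ℂ := Lᵀ * X * Lᵀᴴ with hc
  have hX : X = ∑ i, ∑ j, c i j • (Matrix.of fun a a' => G i a * star (G j a')) := by
    have h1 : X = Gᵀ * c * Gᵀᴴ := by
      have h2 : Gᵀ * Lᵀ = 1 := by rw [← transpose_mul, hLG, transpose_one]
      have h3 : Lᵀᴴ * Gᵀᴴ = 1 := by rw [← conjTranspose_mul, h2, conjTranspose_one]
      calc X = (Gᵀ * Lᵀ) * X * (Lᵀᴴ * Gᵀᴴ) := by rw [h2, h3, Matrix.one_mul, Matrix.mul_one]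
        _ = _ := by rw [hc]; simp only [Matrix.mul_assoc]
    conv_lhs => rw [h1]
    ext a a'
    simp only [Matrix.mul_apply, Matrix.sum_apply, Matrix.smul_apply, Matrix.of_apply, smul_eq_mul,
      transpose_apply, conjTranspose_apply, Finset.sum_mul]
    rw [Finset.sum_comm]
    exact Finset.sum_congr rfl fun _ _ => Finset.sum_congr rfl fun _ _ => by ring
  have hΦ : ∀ i j b b', Φ (Matrix.of fun a a' => G i a * star (G j a')) b b' =
      ∑ k, V (i, b) k * w k * star (V (j, b') k) := by
    intro i j b b'
    have := congrFun (congrFun h (i, b)) (j, b')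
    rw [mul_diagonal_mul_conjTranspose_apply] at this
    exact this
  ext b b'
  have hl : Φ X b b' = ∑ i, ∑ j, c i j * ∑ k, V (i, b) k * w k * star (V (j, b') k) := by
    conv_lhs => rw [hX]
    simp only [map_sum, map_smul, Matrix.sum_apply, Matrix.smul_apply, smul_eq_mul, hΦ]
  have hE : ∀ k, ((Matrix.of fun b a => ∑ i, L a i * V (i, b) k : Matrix B A ℂ)) =
      Matrix.of (fun b i => V (i, b) k) * Lᵀ := by
    intro k; ext b a
    simp [Matrix.mul_apply, mul_comm]
  have hr : ∀ k, conjMap (Matrix.of fun b a => ∑ i, L a i * V (i, b) k : Matrix B A ℂ) X b b' =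
      ∑ i, ∑ j, V (i, b) k * c i j * star (V (j, b') k) := by
    intro k
    have : conjMap (Matrix.of fun b a => ∑ i, L a i * V (i, b) k : Matrix B A ℂ) X =
        Matrix.of (fun b i => V (i, b) k) * c * (Matrix.of (fun b i => V (i, b) k))ᴴ := by
      rw [hE, hc]
      rw [conjMap_apply, conjTranspose_mul]; simp only [Matrix.mul_assoc]
    rw [this, Matrix.mul_apply, Finset.sum_comm]
    simp [Matrix.mul_apply, Finset.sum_mul]
  rw [hl, krausMap]
  simp only [LinearMap.sum_apply, LinearMap.smul_apply, Matrix.sum_apply, Matrix.smul_apply, hr,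
    smul_eq_mul, Finset.mul_sum]
  rw [Finset.sum_comm_cycle]
  exact Finset.sum_congr rfl fun _ _ => Finset.sum_congr rfl fun _ _ =>
    Finset.sum_congr rfl fun _ _ => by ring

/-- If the support condition holds at one pure state of full Schmidt rank, the two channels have
Kraus representations with the same Kraus operators up to scaling. -/
theorem exists_common_kraus {d : ℕ} [Fintype A] [Fintype B] [DecidableEq A] [DecidableEq B]
    {N M : Matrix A A ℂ →ₗ[ℂ] Matrix B B ℂ} (hN : IsChannel N) (hM : IsChannel M)
    {G : Matrix (Fin d) A ℂ} {L : Matrix A (Fin d) ℂ} (hLG : L * G = 1) (hGL : G * L = 1)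
    (hψ : (ketBra fun p : Fin d × A => G p.1 p.2).PosSemidef)
    (h : ∀ v, idTensor (Fin d) M (ketBra fun p : Fin d × A => G p.1 p.2) *ᵥ v = 0 →
      idTensor (Fin d) N (ketBra fun p : Fin d × A => G p.1 p.2) *ᵥ v = 0) :
    ∃ (E : Fin d × B → Matrix B A ℂ) (μ : Fin d × B → ℝ), (∀ k, 0 ≤ μ k) ∧
      M = krausMap (fun _ => 1) E ∧ N = krausMap μ E ∧
      ∀ x : Fin d × B → ℂ, ∑ k, x k • E k = 0 → ∀ k, (μ k : ℂ) * x k = 0 := by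
  obtain ⟨V, μ, hμ, hM', hN', hker⟩ := exists_factorization (hN.1 d _ hψ) (hM.1 d _ hψ) h
  refine ⟨fun k => Matrix.of fun b a => ∑ i, L a i * V (i, b) k, μ, hμ,
    eq_krausMap_of_idTensor_ketBra hLG ?_, eq_krausMap_of_idTensor_ketBra hLG hN'.symm, ?_⟩
  · rw [← hM']; simp
  -- The kernel condition on `V` becomes a condition on linear relations among the Kraus operators,
  -- free of the chosen state; `G` cancels `L`.
  · intro x hx k
    have hV : V *ᵥ x = 0 := by
      ext ⟨i, b⟩
      have h1 : ∀ a, ∑ k, x k * ∑ j, L a j * V (j, b) k = 0 := fun a => by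
        have := congrFun (congrFun hx b) a
        simpa [Matrix.sum_apply] using this
      have h2 : L *ᵥ (fun j => ∑ k, V (j, b) k * x k) = 0 := by
        ext a
        rw [Pi.zero_apply, ← h1 a]
        simp only [mulVec, dotProduct, Finset.mul_sum]
        rw [Finset.sum_comm]
        exact Finset.sum_congr rfl fun _ _ => Finset.sum_congr rfl fun _ _ => by ring
      have h3 := congrArg (fun v => G *ᵥ v) h2
      simp only [Matrix.mulVec_mulVec, hGL, Matrix.one_mulVec, Matrix.mulVec_zero] at h3
      exact congrFun h3 i
    have := congrFun (hker x hV) k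
    simpa [mulVec_diagonal] using this

end Ampliation

/-! ### The divergence as a linear functional of the input -/

section EnergyConstrained

variable {A B κ : Type*} [Fintype A] [Fintype B]

theorem energy_add_smul (H X Y : Matrix A A ℂ) (a b : ℝ) :
    energy H ((a : ℂ) • X + (b : ℂ) • Y) = a * energy H X + b * energy H Y := by
  simp [energy, Matrix.mul_add]

theorem IsState.add_smul {X Y : Matrix A A ℂ} (hX : IsState X) (hY : IsState Y) {a b : ℝ}
    (ha : 0 ≤ a) (hb : 0 ≤ b) (hab : a + b = 1) : IsState ((a : ℂ) • X + (b : ℂ) • Y) := by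
  refine ⟨(hX.1.smul (by exact_mod_cast ha)).add (hY.1.smul (by exact_mod_cast hb)), ?_⟩
  rw [trace_add, trace_smul, trace_smul, hX.2, hY.2, smul_eq_mul, smul_eq_mul, mul_one, mul_one]
  exact_mod_cast hab

theorem energy_nonneg_of_one [DecidableEq A] {H : Matrix A A ℂ} (hH : H.PosSemidef) :
    0 ≤ energy H 1 := by
  rw [energy, Matrix.mul_one]
  exact (Complex.le_def.1 hH.trace_nonneg).1

/-- If the Hamiltonian is grounded, some invertible state has energy at most `E`. -/
theorem exists_posDef_state {H : Matrix A A ℂ} (hH : IsGrounded H) {E : ℝ} (hE : 0 < E) :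
    ∃ ω : Matrix A A ℂ, ω.PosDef ∧ IsState ω ∧ energy H ω ≤ E := by
  classical
  obtain ⟨hHp, g, hg, hHg⟩ := hH
  obtain ⟨a₀, -⟩ := Function.ne_iff.1 hg
  have : Nonempty A := ⟨a₀⟩
  set n : ℂ := g ⬝ᵥ star g with hn
  have hn0 : 0 < n := by
    rw [hn, dotProduct_comm]; exact dotProduct_star_self_pos_iff.2 hg
  have hcard : (0 : ℝ) < Fintype.card A := by exact_mod_cast Fintype.card_pos
  set γ : Matrix A A ℂ := n⁻¹ • ketBra g with hγ
  have hγs : IsState γ := by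
    refine ⟨(posSemidef_vecMulVec_self_star g).smul (inv_nonneg.2 hn0.le), ?_⟩
    rw [hγ, trace_smul, ketBra, trace_vecMulVec, smul_eq_mul, ← hn, inv_mul_cancel₀ hn0.ne']
  have hγe : energy H γ = 0 := by
    rw [energy, hγ, ketBra, Matrix.mul_smul, mul_vecMulVec, hHg]
    simp
  set π : Matrix A A ℂ := (((Fintype.card A : ℝ)⁻¹ : ℝ) : ℂ) • 1 with hπ
  have hπd : π.PosDef := PosDef.one.smul (by exact_mod_cast inv_pos.2 hcard)
  have hπs : IsState π := by
    refine ⟨hπd.posSemidef, ?_⟩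
    rw [hπ, trace_smul, trace_one, smul_eq_mul]
    push_cast
    exact inv_mul_cancel₀ (by exact_mod_cast hcard.ne')
  set t := energy H π with ht
  have ht0 : 0 ≤ t := by
    have h1 : t = (Fintype.card A : ℝ)⁻¹ * energy H 1 := by
      have := energy_add_smul H 1 0 ((Fintype.card A : ℝ)⁻¹) 0
      rw [smul_zero, add_zero] at this
      rw [ht, hπ, this]; simp
    rw [h1]
    exact mul_nonneg (inv_nonneg.2 hcard.le) (energy_nonneg_of_one hHp)
  have hEt : 0 < E + t := by linarith
  -- Mixing a ground state with weight `δ` of the maximally mixed state gives energy `δ * t = E * t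
  -- / (E + t)`, at most `E`.
  set δ := E / (E + t) with hδ
  have hδ0 : 0 < δ := div_pos hE hEt
  have hδ1 : δ ≤ 1 := (div_le_one hEt).2 (by linarith)
  refine ⟨((1 - δ : ℝ) : ℂ) • γ + (δ : ℂ) • π, ?_,
    hγs.add_smul hπs (by linarith) hδ0.le (by ring), ?_⟩
  · exact PosDef.posSemidef_add (hγs.1.smul (by exact_mod_cast (by linarith : 0 ≤ 1 - δ)))
      (hπd.smul (by exact_mod_cast hδ0))
  · rw [energy_add_smul, hγe, mul_zero, zero_add, ← ht, hδ, div_mul_eq_mul_div,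
      div_le_iff₀ hEt]
    nlinarith

/-- Every invertible density matrix has a purification of full Schmidt rank. -/
theorem exists_purification {ρ : Matrix A A ℂ} [DecidableEq A] (hρ : ρ.PosDef) :
    ∃ (G : Matrix (Fin (Fintype.card A)) A ℂ) (L : Matrix A (Fin (Fintype.card A)) ℂ),
      L * G = 1 ∧ G * L = 1 ∧ reduced (ketBra fun p : Fin (Fintype.card A) × A => G p.1 p.2) = ρ := by
  set s := cfc Real.sqrt ρ with hs
  have hss : s * s = ρ := cfc_sqrt_mul_self hρ.posSemidef
  have hsh : sᴴ = s := conjTranspose_cfc _ _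
  have hdet : IsUnit s.det := by
    have : IsUnit (s * s).det := (Matrix.isUnit_iff_isUnit_det _).1 (hss ▸ hρ.isUnit)
    rw [det_mul] at this
    exact isUnit_of_mul_isUnit_left this
  let e := (Fintype.equivFin A).symm
  refine ⟨sᵀ.submatrix e id, (s⁻¹)ᵀ.submatrix id e, ?_, ?_, ?_⟩
  · rw [submatrix_mul_equiv, ← transpose_mul, mul_nonsing_inv _ hdet]; simp
  · have := submatrix_mul_equiv sᵀ (s⁻¹)ᵀ e (Equiv.refl A) e
    rw [← transpose_mul, nonsing_inv_mul _ hdet, transpose_one, submatrix_one_equiv] at this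
    exact this
  · rw [reduced_ketBra, transpose_submatrix, transpose_transpose, conjTranspose_submatrix,
      submatrix_mul_equiv, hsh, hss]; simp

theorem isState_ketBra_of_reduced {R : Type*} [Fintype R] {ψ : R × A → ℂ}
    (h : IsState (reduced (ketBra ψ))) : IsState (ketBra ψ) :=
  ⟨posSemidef_vecMulVec_self_star ψ, by rw [← trace_reduced, h.2]⟩

/-- The linear functional of the input state giving the divergence of the outputs of two channels
with common Kraus operators `E k` and relative weights `μ k`. -/
def divergenceFunctional [Fintype κ] (μ : κ → ℝ) (E : κ → Matrix B A ℂ) (ρ : Matrix A A ℂ) : ℝ :=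
  (krausMap (fun k => μ k * Real.log (μ k)) E ρ).trace.re

theorem divergenceFunctional_add_smul [Fintype κ] (μ : κ → ℝ) (E : κ → Matrix B A ℂ)
    (X Y : Matrix A A ℂ) (a b : ℝ) :
    divergenceFunctional μ E ((a : ℂ) • X + (b : ℂ) • Y) =
      a * divergenceFunctional μ E X + b * divergenceFunctional μ E Y := by
  simp [divergenceFunctional]

/-- Both outputs factor through the same `W`, with weights `μ` and `1`, and the relation condition
`hE` passes to the kernel of `W` because `G` is left invertible. Under the support condition this is
an equality; otherwise the right side is `⊤`. -/
theorem divergenceFunctional_le_bsRelEntropy {R : Type*} [Fintype R] [DecidableEq R]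
    [DecidableEq A] [DecidableEq B] [Fintype κ]
    [DecidableEq κ] {μ : κ → ℝ} {E : κ → Matrix B A ℂ} (hμ : ∀ k, 0 ≤ μ k)
    (hE : ∀ x : κ → ℂ, ∑ k, x k • E k = 0 → ∀ k, (μ k : ℂ) * x k = 0)
    {G : Matrix R A ℂ} {L : Matrix A R ℂ} (hLG : L * G = 1) :
    (divergenceFunctional μ E (reduced (ketBra fun p : R × A => G p.1 p.2)) : EReal) ≤
      bsRelEntropy (idTensor R (krausMap μ E) (ketBra fun p : R × A => G p.1 p.2))
        (idTensor R (krausMap (fun _ => 1) E) (ketBra fun p : R × A => G p.1 p.2)) := by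
  set ψ : R × A → ℂ := fun p => G p.1 p.2 with hψ
  set W : Matrix (R × B) κ ℂ := Matrix.of fun p k => ∑ a, E k p.2 a * ψ (p.1, a) with hW
  rw [bsRelEntropy]
  split_ifs with hs
  · rw [idTensor_krausMap_ketBra μ E ψ W hW, idTensor_krausMap_ketBra _ E ψ W hW]
    simp only [Complex.ofReal_one, diagonal_one, Matrix.mul_one]
    rw [opRelEntropy_of_factorization W μ hμ, divergenceFunctional, ← trace_idTensor,
      idTensor_krausMap_ketBra _ E ψ W hW]
    intro x hx
    have h1 : (∑ k, x k • E k) * Gᵀ = 0 := by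
      ext b r
      have := congrFun hx (r, b)
      simp only [mulVec, dotProduct, hW, Matrix.of_apply, hψ, Pi.zero_apply] at this
      rw [Matrix.zero_apply, ← this]
      simp only [Matrix.mul_apply, Matrix.sum_apply, Matrix.smul_apply, smul_eq_mul,
        transpose_apply, Finset.sum_mul]
      rw [Finset.sum_comm]
      exact Finset.sum_congr rfl fun _ _ => Finset.sum_congr rfl fun _ _ => by ring
    have h2 : ∑ k, x k • E k = 0 := by
      have h3 : Gᵀ * Lᵀ = 1 := by rw [← transpose_mul, hLG, transpose_one]
      rw [← Matrix.mul_one (∑ k, x k • E k), ← h3, ← Matrix.mul_assoc, h1, Matrix.zero_mul]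
    ext k
    rw [mulVec_diagonal, hE x h2 k, Pi.zero_apply]
  · exact le_top

variable [DecidableEq B]

theorem divergenceFunctional_le_of_posDef [Fintype κ] {μ : κ → ℝ} {K : κ → Matrix B A ℂ}
    (hμ : ∀ k, 0 ≤ μ k) (hK : ∀ x : κ → ℂ, ∑ k, x k • K k = 0 → ∀ k, (μ k : ℂ) * x k = 0)
    {H ρ : Matrix A A ℂ} {E : ℝ} (hρd : ρ.PosDef) (hρ : IsState ρ) (hρE : energy H ρ ≤ E) :
    (divergenceFunctional μ K ρ : EReal) ≤
      ecbsDivergence H E (krausMap μ K) (krausMap (fun _ => 1) K) := by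
  classical
  obtain ⟨G, L, hLG, -, hred⟩ := exists_purification hρd
  have h := divergenceFunctional_le_bsRelEntropy hμ hK hLG
  rw [hred] at h
  refine h.trans ?_
  rw [ecbsDivergence]
  refine le_iSup_of_le _ (le_iSup_of_le _ (le_iSup_of_le (isState_ketBra_of_reduced ?_)
    (le_iSup_of_le ?_ le_rfl)))
  · rw [hred]; exact hρ
  · rw [hred]; exact hρE

/-- The divergence functional of an admissible input state is bounded by the energy-constrained
Belavkin–Staszewski channel divergence. -/
theorem divergenceFunctional_le [Fintype κ] {μ : κ → ℝ} {K : κ → Matrix B A ℂ}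
    (hμ : ∀ k, 0 ≤ μ k) (hK : ∀ x : κ → ℂ, ∑ k, x k • K k = 0 → ∀ k, (μ k : ℂ) * x k = 0)
    {H ρ : Matrix A A ℂ} (hH : IsGrounded H) {E : ℝ} (hE : 0 < E) (hρ : IsState ρ)
    (hρE : energy H ρ ≤ E) {C : ℝ}
    (hC : ecbsDivergence H E (krausMap μ K) (krausMap (fun _ => 1) K) = C) :
    divergenceFunctional μ K ρ ≤ C := by
  obtain ⟨ω, hωd, hω, hωE⟩ := exists_posDef_state hH hE
  -- Mixing with `ω` makes the input invertible while keeping it admissible; linearity then allows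
  -- `δ → 0`.
  have hδ : ∀ δ ∈ Set.Ioo (0 : ℝ) 1,
      (1 - δ) * divergenceFunctional μ K ρ + δ * divergenceFunctional μ K ω ≤ C := by
    intro δ hδ
    rw [← divergenceFunctional_add_smul, ← EReal.coe_le_coe_iff, ← hC]
    have h1 : 0 ≤ 1 - δ := by linarith [hδ.2]
    refine divergenceFunctional_le_of_posDef hμ hK ?_
      (hρ.add_smul hω h1 hδ.1.le (by ring)) ?_
    · exact PosDef.posSemidef_add (hρ.1.smul (by exact_mod_cast h1))
        (hωd.smul (by exact_mod_cast hδ.1))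
    · rw [energy_add_smul]
      nlinarith [hδ.1, mul_le_mul_of_nonneg_left hρE h1,
        mul_le_mul_of_nonneg_left hωE hδ.1.le]
  have hcont : Tendsto (fun δ : ℝ =>
      (1 - δ) * divergenceFunctional μ K ρ + δ * divergenceFunctional μ K ω) (𝓝[>] 0)
      (𝓝 ((1 - 0) * divergenceFunctional μ K ρ + 0 * divergenceFunctional μ K ω)) :=
    Tendsto.mono_left (Continuous.tendsto (by fun_prop) 0) nhdsWithin_le_nhds
  have := le_of_tendsto hcont (eventually_of_mem (Ioo_mem_nhdsGT one_pos) hδ)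
  simpa using this

/-- If the channel divergence is finite, it is a real number, and the channels have common Kraus
operators. -/
theorem exists_common_kraus_of_ne_top {N M : Matrix A A ℂ →ₗ[ℂ] Matrix B B ℂ}
    (hN : IsChannel N) (hM : IsChannel M) {H : Matrix A A ℂ} (hH : IsGrounded H) {E : ℝ}
    (hE : 0 < E) (htop : ecbsDivergence H E N M ≠ ⊤) :
    ∃ (K : Fin (Fintype.card A) × B → Matrix B A ℂ) (μ : Fin (Fintype.card A) × B → ℝ),
      (∀ k, 0 ≤ μ k) ∧ M = krausMap (fun _ => 1) K ∧ N = krausMap μ K ∧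
      (∀ x : Fin (Fintype.card A) × B → ℂ, ∑ k, x k • K k = 0 → ∀ k, (μ k : ℂ) * x k = 0) ∧
      ∃ C : ℝ, ecbsDivergence H E N M = C := by
  classical
  obtain ⟨ω, hωd, hω, hωE⟩ := exists_posDef_state hH hE
  obtain ⟨G, L, hLG, hGL, hred⟩ := exists_purification hωd
  have hst : IsState (ketBra fun p : Fin (Fintype.card A) × A => G p.1 p.2) :=
    isState_ketBra_of_reduced (hred ▸ hω)
  have hle : bsRelEntropy
      (idTensor _ N (ketBra fun p : Fin (Fintype.card A) × A => G p.1 p.2))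
      (idTensor _ M (ketBra fun p : Fin (Fintype.card A) × A => G p.1 p.2)) ≤
      ecbsDivergence H E N M :=
    le_iSup_of_le _ (le_iSup_of_le _ (le_iSup_of_le hst
      (le_iSup_of_le (by rw [hred]; exact hωE) le_rfl)))
  rw [bsRelEntropy] at hle
  split_ifs at hle with hs
  · obtain ⟨K, μ, hμ, hMK, hNK, hK⟩ := exists_common_kraus hN hM hLG hGL hst.1 hs
    refine ⟨K, μ, hμ, hMK, hNK, hK, _, (EReal.coe_toReal htop ?_).symm⟩
    exact ((EReal.bot_lt_coe _).trans_le hle).ne'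
  · exact absurd (top_le_iff.1 hle) htop

end EnergyConstrained

/-! ### The classical converse -/

section Classical

/-- Convexity: the left side is the tangent to `x * log x` at `c`. -/
theorem mul_log_ge_tangent {x c : ℝ} (hx : 0 ≤ x) (hc : 0 < c) :
    x * Real.log c + x - c ≤ x * Real.log x := by
  rcases hx.eq_or_lt with rfl | hx
  · simp [hc.le]
  · have h := Real.log_le_sub_one_of_pos (div_pos hc hx)
    rw [Real.log_div hc.ne' hx.ne'] at h
    have h2 := mul_le_mul_of_nonneg_left h hx.le
    have h3 : x * (c / x - 1) = c - x := by field_simp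
    rw [h3] at h2
    linarith

/-- The log-sum inequality in tangent form. -/
theorem sum_mul_log_ge_tangent {ι : Type*} [Fintype ι] {w s : ι → ℝ} (hw : ∀ i, 0 ≤ w i)
    (hs : ∀ i, 0 ≤ s i) {c : ℝ} (hc : 0 < c) :
    (∑ i, w i * s i) * Real.log c + ∑ i, w i * s i - c * ∑ i, s i ≤
      ∑ i, w i * Real.log (w i) * s i := by
  rw [Finset.sum_mul, Finset.mul_sum, ← Finset.sum_add_distrib, ← Finset.sum_sub_distrib]
  refine Finset.sum_le_sum fun i _ => ?_
  have := mul_le_mul_of_nonneg_right (mul_log_ge_tangent (hw i) hc) (hs i)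
  linarith

/-- The converse bound for a classical test whose type-I error is exactly `1 - a`. -/
theorem classical_converse {ι : Type*} [Fintype ι] {w s t : ι → ℝ} (hw : ∀ i, 0 ≤ w i)
    (hs : ∀ i, 0 ≤ s i) (ht : ∀ i, 0 ≤ t i) (hsum : ∑ i, s i + ∑ i, t i = 1) {a : ℝ}
    (ha : 0 < a) (ha1 : a ≤ 1) (hws : ∑ i, w i * s i = a) (hwt : ∑ i, w i * t i = 1 - a) :
    0 < ∑ i, s i ∧ a * -Real.log (∑ i, s i) ≤
      ∑ i, w i * Real.log (w i) * (s i + t i) + Real.binEntropy (1 - a) := by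
  have hq : 0 < ∑ i, s i := by
    refine (Finset.sum_nonneg fun i _ => hs i).lt_of_ne fun h => ha.ne ?_
    have h0 := (Finset.sum_eq_zero_iff_of_nonneg fun i _ => hs i).1 h.symm
    rw [← hws]
    exact (Finset.sum_eq_zero fun i hi => by rw [h0 i hi, mul_zero]).symm
  refine ⟨hq, ?_⟩
  -- At the tangent point `a / ∑ s` the linear terms cancel.
  have h1 := sum_mul_log_ge_tangent hw hs (div_pos ha hq)
  rw [hws, Real.log_div ha.ne' hq.ne', div_mul_cancel₀ _ hq.ne'] at h1
  -- The tangent point `1 - a` leaves a remainder of the right sign, since `∑ t ≤ 1`. If `a = 1`,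
  -- every `w i * t i` vanishes.
  have h2 : (1 - a) * Real.log (1 - a) ≤ ∑ i, w i * Real.log (w i) * t i := by
    rcases (sub_nonneg.2 ha1).eq_or_lt with h | h
    · rw [← h, zero_mul]
      refine (Finset.sum_eq_zero fun i hi => ?_).ge
      have h0 := (Finset.sum_eq_zero_iff_of_nonneg
        fun i _ => mul_nonneg (hw i) (ht i)).1 (hwt.trans h.symm) i hi
      rw [mul_right_comm, h0, zero_mul]
    · have h3 := sum_mul_log_ge_tangent hw ht h
      rw [hwt] at h3
      have h4 : (1 - a) * ∑ i, t i ≤ 1 - a := mul_le_of_le_one_right h.le (by linarith)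
      linarith
  rw [Real.binEntropy_eq_negMulLog_add_negMulLog_one_sub, sub_sub_cancel, Real.negMulLog,
    Real.negMulLog]
  simp only [mul_add, Finset.sum_add_distrib]
  linarith

end Classical

/-! ### Reverse tests -/

section ReverseTest

universe v u

variable {S : Type u} [Fintype S]

/-- A reverse test of cost `c`: a simultaneous decomposition of `X` and `Y` into positive
semidefinite parts whose classical relative entropy is `c`. -/
def HasReverseTest (X Y : Matrix S S ℂ) (c : ℝ) : Prop :=
  ∃ (ι : Type v) (_ : Fintype ι) (w : ι → ℝ) (Z : ι → Matrix S S ℂ),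
    (∀ i, 0 ≤ w i) ∧ (∀ i, (Z i).PosSemidef) ∧ X = ∑ i, (w i : ℂ) • Z i ∧ Y = ∑ i, Z i ∧
      c = ∑ i, w i * Real.log (w i) * (Z i).trace.re

theorem HasReverseTest.refl {X : Matrix S S ℂ} (hX : X.PosSemidef) :
    HasReverseTest.{v} X X 0 :=
  ⟨PUnit, inferInstance, fun _ => 1, fun _ => X, fun _ => zero_le_one, fun _ => hX,
    by simp, by simp, by simp⟩

/-- The channel acts on the parts: the weights are untouched and the traces preserved, so the cost
is unchanged. -/
theorem HasReverseTest.map {T : Type*} [Fintype T] {X Y : Matrix S S ℂ} {c : ℝ}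
    (h : HasReverseTest.{v} X Y c) {Φ : Matrix S S ℂ →ₗ[ℂ] Matrix T T ℂ} (hΦ : IsChannel Φ) :
    HasReverseTest.{v} (Φ X) (Φ Y) c := by
  obtain ⟨ι, _, w, Z, hw, hZ, rfl, rfl, rfl⟩ := h
  refine ⟨ι, inferInstance, w, fun i => Φ (Z i), hw, fun i => hΦ.posSemidef_map (hZ i), ?_, ?_, ?_⟩
  · simp
  · simp
  · simp only [hΦ.2]

/-- Makes costs add when weights multiply; `Real.log 0 = 0` covers zero weights. -/
theorem mul_mul_log_mul (a b : ℝ) :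
    a * b * Real.log (a * b) = a * Real.log a * b + b * Real.log b * a := by
  by_cases ha : a = 0
  · simp [ha]
  by_cases hb : b = 0
  · simp [hb]
  rw [Real.log_mul ha hb]; ring

theorem sum_re_trace_smul {ι : Type*} [Fintype ι] (c : ι → ℝ) (Z : ι → Matrix S S ℂ) :
    (∑ i, (c i : ℂ) • Z i).trace.re = ∑ i, c i * (Z i).trace.re := by
  simp [trace_sum]

/-- A query of the unknown channel increases the cost of a reverse test by the divergence
functional of the input state. -/
theorem HasReverseTest.query {R A B : Type*} [Fintype R] [Fintype A] [Fintype B] {κ : Type v}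
    [Fintype κ] {μ : κ → ℝ} {K : κ → Matrix B A ℂ} (hμ : ∀ k, 0 ≤ μ k)
    (hN : IsChannel (krausMap μ K)) {X Y : Matrix (R × A) (R × A) ℂ} {c : ℝ}
    (h : HasReverseTest.{v} X Y c) :
    HasReverseTest.{v} (idTensor R (krausMap μ K) X) (idTensor R (krausMap (fun _ => 1) K) Y)
      (c + divergenceFunctional μ K (reduced X)) := by
  obtain ⟨ι, _, w, Z, hw, hZ, hX, hY, rfl⟩ := h
  refine ⟨ι × κ, inferInstance, fun p => w p.1 * μ p.2,
    fun p => idTensor R (conjMap (K p.2)) (Z p.1), fun p => mul_nonneg (hw _) (hμ _),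
    fun p => posSemidef_idTensor_conjMap _ (hZ _), ?_, ?_, ?_⟩
  · rw [hX, idTensor_sum, Fintype.sum_prod_type]
    refine Finset.sum_congr rfl fun i _ => ?_
    rw [idTensor_krausMap, Finset.smul_sum]
    exact Finset.sum_congr rfl fun k _ => by push_cast; rw [smul_smul]
  · have : Y = ∑ i, (1 : ℂ) • Z i := by simp [hY]
    rw [this, idTensor_sum, Fintype.sum_prod_type]
    refine Finset.sum_congr rfl fun i _ => ?_
    rw [idTensor_krausMap]; simp
  -- Trace preservation by $\mathcal N$ sums out the new weights, leaving the old cost.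
  · have h1 : ∀ i, (Z i).trace.re =
        ∑ k, μ k * (idTensor R (conjMap (K k)) (Z i)).trace.re := fun i => by
      rw [← hN.trace_idTensor, idTensor_krausMap, sum_re_trace_smul]
    have h2 : divergenceFunctional μ K (reduced X) = ∑ i, ∑ k, w i * (μ k * Real.log (μ k)) *
        (idTensor R (conjMap (K k)) (Z i)).trace.re := by
      rw [divergenceFunctional, ← trace_idTensor, hX, idTensor_sum, sum_re_trace_smul]
      refine Finset.sum_congr rfl fun i _ => ?_
      rw [idTensor_krausMap, sum_re_trace_smul, Finset.mul_sum]
      exact Finset.sum_congr rfl fun k _ => by ring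
    rw [h2, Fintype.sum_prod_type, ← Finset.sum_add_distrib]
    refine Finset.sum_congr rfl fun i _ => ?_
    rw [h1 i, Finset.mul_sum, ← Finset.sum_add_distrib]
    refine Finset.sum_congr rfl fun k _ => ?_
    rw [mul_mul_log_mul]; ring

theorem re_trace_mul_nonneg {Q Z : Matrix S S ℂ} (hQ : Q.PosSemidef) (hZ : Z.PosSemidef) :
    0 ≤ (Q * Z).trace.re := by
  classical
  have h : (Q * Z).trace = (cfc Real.sqrt Q * Z * (cfc Real.sqrt Q)ᴴ).trace := by
    rw [conjTranspose_cfc, Matrix.mul_assoc, trace_mul_comm (cfc Real.sqrt Q), Matrix.mul_assoc,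
      cfc_sqrt_mul_self hQ, trace_mul_comm]
  rw [h]
  exact (Complex.le_def.1 (hZ.mul_mul_conjTranspose_same _).trace_nonneg).1

/-- The converse bound for the binary test `(Q₀, Q₁)`. -/
theorem HasReverseTest.converse [DecidableEq S] {X Y Q₀ Q₁ : Matrix S S ℂ} {c : ℝ}
    (h : HasReverseTest.{v} X Y c) (hX : IsState X) (hY : IsState Y) (hQ₀ : Q₀.PosSemidef)
    (hQ₁ : Q₁.PosSemidef) (hQ : Q₀ + Q₁ = 1) {ε : ℝ} (hε0 : 0 ≤ ε) (hε1 : ε < 1)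
    (hε : (Q₁ * X).trace.re ≤ ε) :
    0 < (Q₀ * Y).trace.re ∧
      (1 - ε) * -Real.log (Q₀ * Y).trace.re ≤ c + Real.binEntropy ε := by
  obtain ⟨ι, _, w, Z, hw, hZ, hXZ, hYZ, rfl⟩ := h
  set s : ι → ℝ := fun i => (Q₀ * Z i).trace.re with hs
  set z : ι → ℝ := fun i => (Z i).trace.re with hz
  have hs0 : ∀ i, 0 ≤ s i := fun i => re_trace_mul_nonneg hQ₀ (hZ i)
  have hsz : ∀ i, s i ≤ z i := fun i => by
    have h1 := re_trace_mul_nonneg hQ₁ (hZ i)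
    have h2 : z i = s i + (Q₁ * Z i).trace.re := by
      rw [hs, hz, ← Complex.add_re, ← trace_add, ← Matrix.add_mul, hQ, Matrix.one_mul]
    linarith
  have hq : (Q₀ * Y).trace.re = ∑ i, s i := by
    rw [hYZ, Matrix.mul_sum, trace_sum, Complex.re_sum]
  have hp : (Q₀ * X).trace.re = ∑ i, w i * s i := by
    rw [hXZ, Matrix.mul_sum, ← sum_re_trace_smul]; simp
  have hzY : ∑ i, z i = 1 := by
    have : Y.trace.re = ∑ i, z i := by rw [hYZ, trace_sum, Complex.re_sum]
    rw [← this, hY.2, Complex.one_re]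
  have hzX : ∑ i, w i * z i = 1 := by
    rw [← sum_re_trace_smul, ← hXZ, hX.2, Complex.one_re]
  set p := ∑ i, w i * s i with hpd
  have hpε : 1 - ε ≤ p := by
    have : (Q₀ * X).trace.re + (Q₁ * X).trace.re = 1 := by
      rw [← Complex.add_re, ← trace_add, ← Matrix.add_mul, hQ, Matrix.one_mul, hX.2,
        Complex.one_re]
    linarith
  have hε' : 0 < 1 - ε := by linarith
  have hp0 : 0 < p := hε'.trans_le hpε
  -- Shrinking `Q₀` by `r` makes the type-I error exactly `ε`, as `classical_converse` needs, and
  -- does not increase the type-II error.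
  set r := (1 - ε) / p with hr
  have hr0 : 0 ≤ r := (div_pos hε' hp0).le
  have hr1 : r ≤ 1 := (div_le_one hp0).2 hpε
  have hrs : ∀ i, r * s i ≤ s i := fun i => mul_le_of_le_one_left (hs0 i) hr1
  have hwrs : ∑ i, w i * (r * s i) = 1 - ε := by
    simp only [mul_left_comm _ r]
    rw [← Finset.mul_sum, ← hpd, hr, div_mul_cancel₀ _ hp0.ne']
  obtain ⟨h1, h2⟩ := classical_converse (t := fun i => z i - r * s i) hw
    (fun i => mul_nonneg hr0 (hs0 i)) (fun i => sub_nonneg.2 ((hrs i).trans (hsz i)))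
    (by rw [← Finset.sum_add_distrib]; simp [hzY]) hε' (by linarith) hwrs
    (by simp only [mul_sub, Finset.sum_sub_distrib, hzX, hwrs])
  have h3 : ∑ i, r * s i ≤ ∑ i, s i := Finset.sum_le_sum fun i _ => hrs i
  rw [hq]
  refine ⟨h1.trans_le h3, ?_⟩
  simp only [add_sub_cancel, sub_sub_cancel] at h2
  exact (mul_le_mul_of_nonneg_left (neg_le_neg (Real.log_le_log h1 h3)) hε'.le).trans h2

end ReverseTest

/-! ### Adaptive protocols -/

section Adaptive

universe v

variable {A : Type*} {B : Type*} [Fintype A] [Fintype B] [DecidableEq B] {n : ℕ}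

theorem Protocol.isState_probe (P : Protocol A B n) {Φ : Matrix A A ℂ →ₗ[ℂ] Matrix B B ℂ}
    (hΦ : IsChannel Φ) (j : ℕ) (hj : j < n) : IsState (P.probe Φ j) := by
  induction j with
  | zero => exact P.init_isState
  | succ j ih => exact (P.adapt_isChannel j hj).isState_map (hΦ.isState_idTensor (ih (by omega)))

theorem Protocol.isState_averageInput (P : Protocol A B n)
    {Φ : Matrix A A ℂ →ₗ[ℂ] Matrix B B ℂ} (hΦ : IsChannel Φ) (hn : 1 ≤ n) :
    IsState (P.averageInput Φ) := by
  have h : ∀ j ∈ Finset.range n, IsState (reduced (P.probe Φ j)) := fun j hj =>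
    (P.isState_probe hΦ j (Finset.mem_range.1 hj)).reduced
  have hn0 : (n : ℂ) ≠ 0 := by exact_mod_cast (by omega : n ≠ 0)
  have hpos : (0 : ℂ) ≤ 1 / (n : ℂ) := by
    rw [one_div]; exact inv_nonneg.2 (Nat.cast_nonneg n)
  refine ⟨(posSemidef_sum _ fun j hj => (h j hj).1).smul hpos, ?_⟩
  rw [Protocol.averageInput, trace_smul, trace_sum, Finset.sum_congr rfl fun j hj => (h j hj).2]
  simp [hn0]

theorem sum_divergenceFunctional_probe {κ : Type*} [Fintype κ] (μ : κ → ℝ)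
    (K : κ → Matrix B A ℂ) (P : Protocol A B n) (Φ : Matrix A A ℂ →ₗ[ℂ] Matrix B B ℂ)
    (hn : 1 ≤ n) :
    ∑ j ∈ Finset.range n, divergenceFunctional μ K (reduced (P.probe Φ j)) =
      n * divergenceFunctional μ K (P.averageInput Φ) := by
  have hn0 : (n : ℂ) ≠ 0 := by exact_mod_cast (by omega : n ≠ 0)
  have h : ∑ j ∈ Finset.range n, reduced (P.probe Φ j) = (n : ℂ) • P.averageInput Φ := by
    rw [Protocol.averageInput, smul_smul, mul_one_div_cancel hn0, one_smul]
  simp only [divergenceFunctional]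
  rw [← Complex.re_sum, ← trace_sum, ← map_sum, h]
  simp

variable {κ : Type v} [Fintype κ] {μ : κ → ℝ} {K : κ → Matrix B A ℂ}

theorem Protocol.hasReverseTest_probe (P : Protocol A B n) (hμ : ∀ k, 0 ≤ μ k)
    (hN : IsChannel (krausMap μ K)) (j : ℕ) (hj : j < n) :
    HasReverseTest.{v} (P.probe (krausMap μ K) j) (P.probe (krausMap (fun _ => 1) K) j)
      (∑ l ∈ Finset.range j, divergenceFunctional μ K (reduced (P.probe (krausMap μ K) l))) := by
  induction j with
  | zero =>
    rw [Finset.sum_range_zero]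
    exact HasReverseTest.refl P.init_isState.1
  | succ j ih =>
    rw [Finset.sum_range_succ]
    exact ((ih (by omega)).query hμ hN).map (P.adapt_isChannel j hj)

theorem Protocol.hasReverseTest_output (P : Protocol A B n) (hμ : ∀ k, 0 ≤ μ k)
    (hN : IsChannel (krausMap μ K)) (hn : 1 ≤ n) :
    HasReverseTest.{v} (P.output (krausMap μ K)) (P.output (krausMap (fun _ => 1) K))
      (n * divergenceFunctional μ K (P.averageInput (krausMap μ K))) := by
  rw [← sum_divergenceFunctional_probe μ K P _ hn]
  -- The last query, at index `n - 1`, is followed by no adaptation channel.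
  have h := (P.hasReverseTest_probe hμ hN (n - 1) (by omega)).query hμ hN
  rwa [← Finset.sum_range_succ, Nat.sub_add_cancel hn] at h

/-- The converse bound for a single protocol when the channel divergence is finite. -/
theorem Protocol.converse (P : Protocol A B n) {N M : Matrix A A ℂ →ₗ[ℂ] Matrix B B ℂ}
    (hN : IsChannel N) (hM : IsChannel M) {H : Matrix A A ℂ} (hH : IsGrounded H) {E : ℝ}
    (hE : 0 < E) {C : ℝ} (hC : ecbsDivergence H E N M = C) (hn : 1 ≤ n) {ε : ℝ} (hε0 : 0 ≤ ε)
    (hε1 : ε < 1) (hPE : P.ObeysEnergyConstraint H E N M) (hPε : P.typeIError N ≤ ε) :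
    0 < P.typeIIError M ∧
      (1 - ε) * -Real.log (P.typeIIError M) ≤ n * C + Real.binEntropy ε := by
  obtain ⟨K, μ, hμ, rfl, rfl, hK, -⟩ :=
    exists_common_kraus_of_ne_top hN hM hH hE (by rw [hC]; exact EReal.coe_ne_top C)
  have hF := divergenceFunctional_le hμ hK hH hE (P.isState_averageInput hN hn) hPE.1 hC
  obtain ⟨h1, h2⟩ := (P.hasReverseTest_output hμ hN hn).converse
    (hN.isState_idTensor (P.isState_probe hN _ (by omega)))
    (hM.isState_idTensor (P.isState_probe hM _ (by omega)))
    P.Q₀_posSemidef P.Q₁_posSemidef P.Q_sum hε0 hε1 hPε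
  refine ⟨h1, h2.trans ?_⟩
  have := mul_le_mul_of_nonneg_left hF (Nat.cast_nonneg (α := ℝ) n)
  linarith

theorem typeIIRate_le_of_eq_coe {N M : Matrix A A ℂ →ₗ[ℂ] Matrix B B ℂ}
    (hN : IsChannel N) (hM : IsChannel M) {H : Matrix A A ℂ} (hH : IsGrounded H) {E : ℝ}
    (hE : 0 < E) {C : ℝ} (hC : ecbsDivergence H E N M = C) (hn : 1 ≤ n) {ε : ℝ} (hε0 : 0 ≤ ε)
    (hε1 : ε < 1) :
    typeIIRate H E N M n ε ≤ ((1 / (1 - ε) * (C + Real.binEntropy ε / n) : ℝ) : EReal) := by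
  have hn0 : (0 : ℝ) < n := by exact_mod_cast hn
  have hε : 0 < 1 - ε := by linarith
  set x : ℝ := (n * C + Real.binEntropy ε) / (1 - ε) with hx
  have hβ : ENNReal.ofReal (Real.exp (-x)) ≤ optimalTypeIIError H E N M n ε := by
    refine le_iInf fun P => le_iInf fun hPE => le_iInf fun hPε => ENNReal.ofReal_le_ofReal ?_
    obtain ⟨h1, h2⟩ := P.converse hN hM hH hE hC hn hε0 hε1 hPE hPε
    rw [← Real.le_log_iff_exp_le h1]
    have : -Real.log (P.typeIIError M) ≤ x := by
      rw [hx, le_div_iff₀ hε]; linarith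
    linarith
  have hlog : -ENNReal.log (optimalTypeIIError H E N M n ε) ≤ (x : EReal) := by
    have := ENNReal.log_monotone hβ
    rw [ENNReal.log_ofReal_of_pos (Real.exp_pos _), Real.log_exp] at this
    rw [EReal.neg_le, ← EReal.coe_neg]
    exact this
  have hn0' : (0 : EReal) ≤ (n : EReal) := by exact_mod_cast hn0.le
  refine (EReal.div_le_div_right_of_nonneg hn0' hlog).trans (le_of_eq ?_)
  rw [← EReal.coe_natCast, ← EReal.coe_div]
  congr 1
  rw [hx]; field_simp

/-- A larger `ε` admits more protocols. This monotonicity is what makes the limit as `ε → 0⁺` exist.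
-/
theorem typeIIRate_mono (H : Matrix A A ℂ) (E : ℝ) (N M : Matrix A A ℂ →ₗ[ℂ] Matrix B B ℂ)
    (n : ℕ) : Monotone (typeIIRate H E N M n) := by
  intro ε ε' h
  refine EReal.div_le_div_right_of_nonneg (by exact_mod_cast Nat.zero_le n) ?_
  rw [EReal.neg_le_neg_iff]
  refine ENNReal.log_monotone ?_
  exact iInf_mono fun P => iInf_mono fun _ => iInf_mono' fun hP => ⟨hP.trans h, le_rfl⟩

end Adaptive

end ChannelDiscrimination

end

/-! ### The rate bound and its limit -/

theorem mainTheorem2 {A B : Type*} [Fintype A] [Fintype B] [DecidableEq B]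
    (N M : Matrix A A ℂ →ₗ[ℂ] Matrix B B ℂ)
    (hN : ChannelDiscrimination.IsChannel N) (hM : ChannelDiscrimination.IsChannel M)
    (H : Matrix A A ℂ) (hH : ChannelDiscrimination.IsGrounded H) (E : ℝ) (hE : 0 < E) :
    (∀ (n : ℕ) (ε : ℝ), 1 ≤ n → 0 ≤ ε → ε < 1 →
      ChannelDiscrimination.typeIIRate H E N M n ε ≤
        ((1 / (1 - ε) : ℝ) : EReal) *
          (ChannelDiscrimination.ecbsDivergence H E N M +
            ((Real.binEntropy ε / (n : ℝ) : ℝ) : EReal))) ∧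
    ∃ L : EReal,
      Tendsto
        (fun ε : ℝ => limsup (fun n : ℕ => ChannelDiscrimination.typeIIRate H E N M n ε) atTop)
        (𝓝[>] (0 : ℝ)) (𝓝 L) ∧
      L ≤ ChannelDiscrimination.ecbsDivergence H E N M := by
  have hmono : Monotone fun ε : ℝ =>
      limsup (fun n : ℕ => ChannelDiscrimination.typeIIRate H E N M n ε) atTop := fun ε ε' h =>
    limsup_le_limsup (Eventually.of_forall fun n =>
      ChannelDiscrimination.typeIIRate_mono H E N M n h)
  have hlim := hmono.tendsto_nhdsGT 0
  by_cases htop : ChannelDiscrimination.ecbsDivergence H E N M = ⊤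
  · refine ⟨fun n ε hn hε0 hε1 => ?_, _, hlim, by rw [htop]; exact le_top⟩
    rw [htop, EReal.top_add_coe, EReal.coe_mul_top_of_pos (one_div_pos.2 (by linarith))]
    exact le_top
  · obtain ⟨-, -, -, -, -, -, C, hC⟩ :=
      ChannelDiscrimination.exists_common_kraus_of_ne_top hN hM hH hE htop
    have hbound : ∀ (n : ℕ) (ε : ℝ), 1 ≤ n → 0 ≤ ε → ε < 1 →
        ChannelDiscrimination.typeIIRate H E N M n ε ≤
          ((1 / (1 - ε) * (C + Real.binEntropy ε / n) : ℝ) : EReal) := fun n ε hn hε0 hε1 =>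
      ChannelDiscrimination.typeIIRate_le_of_eq_coe hN hM hH hE hC hn hε0 hε1
    refine ⟨fun n ε hn hε0 hε1 => ?_, _, hlim, ?_⟩
    · rw [hC, ← EReal.coe_add, ← EReal.coe_mul]
      exact hbound n ε hn hε0 hε1
    · rw [hC]
      have hε : ∀ ε ∈ Set.Ioo (0 : ℝ) 1,
          limsup (fun n : ℕ => ChannelDiscrimination.typeIIRate H E N M n ε) atTop ≤
            ((1 / (1 - ε) * C : ℝ) : EReal) := by
        intro ε hε
        have ht : Tendsto (fun n : ℕ =>
            ((1 / (1 - ε) * (C + Real.binEntropy ε / n) : ℝ) : EReal)) atTop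
            (𝓝 ((1 / (1 - ε) * C : ℝ) : EReal)) := by
          rw [EReal.tendsto_coe]
          have := ((tendsto_const_div_atTop_nhds_zero_nat (Real.binEntropy ε)).const_add
            C).const_mul (1 / (1 - ε))
          rwa [add_zero] at this
        rw [← ht.limsup_eq]
        exact limsup_le_limsup ((eventually_ge_atTop 1).mono fun n hn =>
          hbound n ε hn hε.1.le hε.2)
      have hc : Tendsto (fun ε : ℝ => ((1 / (1 - ε) * C : ℝ) : EReal)) (𝓝[>] 0)
          (𝓝 (C : EReal)) := by
        rw [EReal.tendsto_coe]
        have : ContinuousAt (fun ε : ℝ => 1 / (1 - ε) * C) 0 := by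
          refine ContinuousAt.mul (ContinuousAt.div continuousAt_const ?_ (by norm_num))
            continuousAt_const
          fun_prop
        have h2 := this.tendsto
        simp only [sub_zero, div_one, one_mul] at h2
        exact h2.mono_left nhdsWithin_le_nhds
      exact le_of_tendsto_of_tendsto hlim hc
        (eventually_of_mem (Ioo_mem_nhdsGT one_pos) hε)
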